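/- There is an absolute constant $c>0$ with the following property. Let $d,n\ge 0$ be integers, let $\|\cdot\|$ be a norm on $\mathbb{R}^d$ and $D>0$ such that $(\mathbb{R}^d,\|\cdot\|)$ is $(2,D)$-smooth, i.e. \[ \|y+z\|^2+\|y-z\|^2\le 2\|y\|^2+2D^2\|z\|^2\qquad\text{for all } y,z\in\mathbb{R}^d. \] Let $\varepsilon,\beta,\gamma>0$, let $V_1,\dots,V_n\subset\mathbb{R}^d$, and let \[ x=\sum_{i=1}^n\sum_{j=1}^{d+1}\lambda_{ij}v_{ij}\in\sum_{i=1}^n \mathrm{Co}(V_i), \] where $v_{ij}\in V_i$, $\lambda_{ij}\ge 0$, $\sum_{j}\lambda_{ij}=1$ for every $i$, and at most $n+d$ of the coefficients $\lambda_{ij}$ are nonzero (as can always be arranged by Carathéodory's theorem). Put \[ R_v=\max_{\{ij:\lambda_{ij}\ne1\}}\|\lambda_{ij}v_{ij}\|,\qquad R_\lambda=\max_{\{ij:\lambda_{ij}\neq 1\}}|\lambda_{ij}|,\qquad R=\max\{\beta D R_v,\gamma R_\lambda\} \] (a maximum over the empty set is $0$). Then there are a point $\hat x\in\mathbb{R}^d$,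 coefficients $\mu_i\ge0$ ($i=1,\dots,n$) and disjoint index sets $S,T\subset\{1,\dots,n\}$ such that $q:=|S|+|T|\le d$, \[ \hat x\in\sum_{i\notin S\cup T}V_i+\sum_{i\in T}\mu_iV_i+\sum_{i\in S}\mu_i\,\mathrm{Co}(V_i), \] \[ \|x-\hat x\|\le\frac{q}{\beta}\varepsilon,\qquad \Bigl|\sum_{i\in S\cup T}\mu_i-q\Bigr|\le q\varepsilon,\qquad \Bigl(\sum_{i\in S\cup T}(\mu_i-1)^2\Bigr)^{1/2}\le\frac{q}{\gamma}\varepsilon, \] and $|S|\le (m-|T|)/2$, where \[ m=1+(d+q)\,\frac{c\,\bigl(\sqrt{d+q}\,R/(q\varepsilon)\bigr)^2}{1+c\,\bigl(\sqrt{d+q}\,R/(q\varepsilon)\bigr)^2} \] (with $m=1$ if $q=0$, in which case $S=T=\emptyset$ and the bound holds trivially); hence, in particular, $|S|\le m-q$. Here sums of sets are Minkowski sums and $\mathrm{Co}$ is the convex hull. -/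

import Mathlib

open scoped Pointwise

noncomputable section

namespace ApproxSF

/-- A seminorm on `ℝ^d` is a norm if it vanishes only at the origin. -/
def IsNorm {d : ℕ} (N : Seminorm ℝ (Fin d → ℝ)) : Prop :=
  ∀ x, N x = 0 → x = 0

/-- `(ℝ^d, N)` is `(2, D)`-smooth. -/
def IsTwoSmooth {d : ℕ} (N : Seminorm ℝ (Fin d → ℝ)) (D : ℝ) : Prop :=
  0 < D ∧ ∀ x y, N (x + y) ^ 2 + N (x - y) ^ 2 ≤ 2 * N x ^ 2 + 2 * D ^ 2 * N y ^ 2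

/-- `R_v = max { ‖λ_ij v_ij‖ : λ_ij ≠ 1 }`, the maximum of the empty set being `0`. -/
def Rv {d n : ℕ} (N : Seminorm ℝ (Fin d → ℝ)) (lam : Fin n → Fin (d + 1) → ℝ)
    (v : Fin n → Fin (d + 1) → (Fin d → ℝ)) : ℝ :=
  ⨆ p : {p : Fin n × Fin (d + 1) // lam p.1 p.2 ≠ 1},
    N (lam p.1.1 p.1.2 • v p.1.1 p.1.2)

/-- `R_λ = max { |λ_ij| : λ_ij ≠ 1 }`, the maximum of the empty set being `0`. -/
def Rlam {d n : ℕ} (lam : Fin n → Fin (d + 1) → ℝ) : ℝ :=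
  ⨆ p : {p : Fin n × Fin (d + 1) // lam p.1 p.2 ≠ 1}, |lam p.1.1 p.1.2|

/-- `R = max {β D R_v, γ R_λ}`. -/
def radius {d n : ℕ} (N : Seminorm ℝ (Fin d → ℝ)) (D β γ : ℝ)
    (lam : Fin n → Fin (d + 1) → ℝ) (v : Fin n → Fin (d + 1) → (Fin d → ℝ)) : ℝ :=
  max (β * D * Rv N lam v) (γ * Rlam lam)

/-- The number `m` of sampled coefficients; for `q = 0` division by zero makes it `1`. -/
def sampleSize (c R ε : ℝ) (d q : ℕ) : ℝ :=
  1 + ((d : ℝ) + q) *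
    (c * (√((d : ℝ) + q) * R / (q * ε)) ^ 2 /
      (1 + c * (√((d : ℝ) + q) * R / (q * ε)) ^ 2))

end ApproxSF

end

/-!
The approximating point is found with all multipliers `μ i` equal to `1`, so that only the distance
`N (x - xhat)` has to be controlled. Let `x i = ∑ j, lam i j • v i j`, let `F` be the set of indices
`i` with a fractional coefficient, and let `k i` be the number of nonzero coefficients of `x i`.
Then `∑ i ∈ F, k i ≤ d + |F|` and `k i ≥ 2` on `F`, whence `|F| ≤ d`. The task is to replace each
`x i` by a point of `Co (V i)` which, except for the indices in a small set `S`, lies in `V i`.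
Because the multipliers are `1`, any index of `F` may be put into `T`, so `q` may be any integer between `|S|`
and `|F|`, and the requirements are an error of at most `q * ε / β` and `|S| + q ≤ m`. With
`r = R / (β * D)` and `δ = R / ε` the error bound reads `δ * error ≤ q * D * r`, while all
`lam i j • v i j` with `i ∈ F` have norm at most `r`.

There are two ways of rounding.

* Low sampling ratio. `exists_sparse_distribution` rounds each `x i` at random, with a parameter `p`,
  so that it stays outside `V i` with probability `O(k i * p)` and has variance
  `O(k i * r ^ 2 / p)`. Smoothness makes variances add up (`sum_sq_add_le_of_mean_zero`), and
  `exists_sparse_rounding` gives `|S| = O(d * p)` with squared error `O(d * (D * r) ^ 2 / p)`. With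
  `p` proportional to `q / d` the error is admissible as soon as `q ^ 3` is at least a constant times
  `δ ^ 2 * d ^ 2`. For the least such `q` the bound `|S| + q ≤ m` holds, provided `q ≤ |F|` and
  `q ≤ 3 * d / 5`; if `q = 1`, then `S` is empty and nothing is to be checked.

* High sampling ratio. In the remaining cases `|F| ^ 3 = O(δ ^ 2 * d ^ 2)`, and `q = |F|` is chosen.
  If `|F| ≤ 3 * d / 5`, then `m ≥ 2 * |F|`, so `S = F` is admissible and no rounding is needed.
  Otherwise `m ≥ 1 + d + q - η`, where `η = q ^ 2 / (c * δ ^ 2)` is a small fraction of `d`, so it is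
  enough to remove about `η` indices from `S = F`. If few indices have `k i = 2`, then `|F|` is well
  below `d` and again none has to be removed. If many have, then such an `x i` can be moved to the end
  of its segment with the larger weight, and equally far in the opposite direction
  (`exists_reflection`). Pairing such indices and choosing signs by smoothness
  (`exists_paired_rounding`) removes about `η` of them with squared error `O(η * (D * r) ^ 2)`, which
  is admissible.
-/

namespace ApproxSF

/-! ### Averaging in smooth spaces and random rounding of one summand -/

section Smooth

variable {E : Type*} [AddCommGroup E] [Module ℝ E] {N : Seminorm ℝ E} {D : ℝ}

theorem exists_sign_sq_le
    (h : ∀ x y, N (x + y) ^ 2 + N (x - y) ^ 2 ≤ 2 * N x ^ 2 + 2 * D ^ 2 * N y ^ 2)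
    (y z : E) :
    N (y + z) ^ 2 ≤ N y ^ 2 + D ^ 2 * N z ^ 2 ∨ N (y - z) ^ 2 ≤ N y ^ 2 + D ^ 2 * N z ^ 2 := by
  by_contra! hc
  linarith [h y z]

/-- In a `(2, D)`-smooth space the mean square grows by at most `2 * D ^ 2` times the second moment
of a centred increment: average the smoothness inequality and bound the mean of `N (y - z) ^ 2` from
below by Jensen's inequality. -/
theorem sum_sq_add_le_of_mean_zero
    (h : ∀ x y, N (x + y) ^ 2 + N (x - y) ^ 2 ≤ 2 * N x ^ 2 + 2 * D ^ 2 * N y ^ 2)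
    {Ω : Type*} (t : Finset Ω) (w : Ω → ℝ) (z : Ω → E) (hw : ∀ o ∈ t, 0 ≤ w o)
    (hw1 : ∑ o ∈ t, w o = 1) (hz : ∑ o ∈ t, w o • z o = 0) (y : E) :
    ∑ o ∈ t, w o * N (y + z o) ^ 2 ≤ N y ^ 2 + 2 * D ^ 2 * ∑ o ∈ t, w o * N (z o) ^ 2 := by
  have jensen : N y ^ 2 ≤ ∑ o ∈ t, w o * N (y - z o) ^ 2 := by
    have e : y = ∑ o ∈ t, w o • (y - z o) := by
      simp only [smul_sub, Finset.sum_sub_distrib, hz, ← Finset.sum_smul, hw1]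
      simp
    have h1 : N y ≤ ∑ o ∈ t, w o * N (y - z o) := by
      calc N y = N (∑ o ∈ t, w o • (y - z o)) := by rw [← e]
        _ ≤ ∑ o ∈ t, N (w o • (y - z o)) :=
          Finset.le_sum_of_subadditive N (map_zero N).le (map_add_le_add N) t _
        _ = _ := Finset.sum_congr rfl fun o ho => by
          rw [map_smul_eq_mul, Real.norm_of_nonneg (hw o ho)]
    have h2 := (even_two.convexOn_pow (𝕜 := ℝ)).map_sum_le (t := t) (w := w)
      (p := fun o => N (y - z o)) hw hw1 (fun _ _ => Set.mem_univ _)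
    simp only [smul_eq_mul] at h2
    exact (pow_le_pow_left₀ (apply_nonneg N y) h1 2).trans h2
  have h3 : ∑ o ∈ t, w o * N (y + z o) ^ 2 + ∑ o ∈ t, w o * N (y - z o) ^ 2
      ≤ ∑ o ∈ t, w o * (2 * N y ^ 2 + 2 * D ^ 2 * N (z o) ^ 2) := by
    rw [← Finset.sum_add_distrib]
    refine Finset.sum_le_sum fun o ho => ?_
    rw [← mul_add]
    exact mul_le_mul_of_nonneg_left (h _ _) (hw o ho)
  have h4 : ∑ o ∈ t, w o * (2 * N y ^ 2 + 2 * D ^ 2 * N (z o) ^ 2)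
      = 2 * N y ^ 2 + 2 * D ^ 2 * ∑ o ∈ t, w o * N (z o) ^ 2 := by
    simp only [mul_add, Finset.sum_add_distrib, ← Finset.sum_mul, hw1, Finset.mul_sum]
    congr 1
    · ring
    · exact Finset.sum_congr rfl fun o _ => by ring
  linarith

theorem exists_le_of_average_le {Ω : Type*} (t : Finset Ω) (w f : Ω → ℝ)
    (hw : ∀ o ∈ t, 0 ≤ w o) (hw1 : ∑ o ∈ t, w o = 1) (M : ℝ) (hM : ∑ o ∈ t, w o * f o ≤ M) :
    ∃ o ∈ t, f o ≤ M := by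
  by_contra! hc
  have h1 : ∑ o ∈ t, w o * (f o - M) ≤ 0 := by
    simp only [mul_sub, Finset.sum_sub_distrib, ← Finset.sum_mul, hw1]
    linarith
  have h2 : ∀ o ∈ t, 0 ≤ w o * (f o - M) := fun o ho =>
    mul_nonneg (hw o ho) (by linarith [hc o ho])
  have h3 := (Finset.sum_eq_zero_iff_of_nonneg h2).1 (le_antisymm h1 (Finset.sum_nonneg h2))
  have : ∑ o ∈ t, w o = 0 := Finset.sum_eq_zero fun o ho => by
    rcases mul_eq_zero.1 (h3 o ho) with h | h
    · exact h
    · linarith [hc o ho]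
  linarith

theorem sum_product_smul {ι κ F : Type*} [AddCommGroup F] [Module ℝ F] (s : Finset ι)
    (t : Finset κ) (a : ι → ℝ) (b : κ → ℝ) (g : ι → F) :
    ∑ x ∈ s ×ˢ t, (a x.1 * b x.2) • g x.1 = (∑ o ∈ t, b o) • ∑ j ∈ s, a j • g j := by
  rw [Finset.sum_product, Finset.smul_sum]
  refine Finset.sum_congr rfl fun j _ => ?_
  rw [Finset.sum_smul]
  exact Finset.sum_congr rfl fun o _ => by rw [smul_smul, mul_comm]

theorem sum_product_smul' {ι κ F : Type*} [AddCommGroup F] [Module ℝ F] (s : Finset ι)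
    (t : Finset κ) (a : ι → ℝ) (b : κ → ℝ) (g : κ → F) :
    ∑ x ∈ s ×ˢ t, (a x.1 * b x.2) • g x.2 = (∑ j ∈ s, a j) • ∑ o ∈ t, b o • g o := by
  rw [Finset.sum_product, Finset.sum_smul]
  refine Finset.sum_congr rfl fun j _ => ?_
  rw [Finset.smul_sum]
  exact Finset.sum_congr rfl fun o _ => by rw [smul_smul]

/-- Splitting a sum over the support of `lam` into the large and the small coefficients. -/
theorem sum_threshold {F ι : Type*} [AddCommGroup F] [Fintype ι] (lam : ι → ℝ) (p : ℝ)
    (f : ι → F) (hf : ∀ j, lam j = 0 → f j = 0) :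
    ∑ j with p ≤ lam j, f j + ∑ j with lam j ≠ 0 ∧ lam j < p, f j = ∑ j, f j := by
  classical
  rw [← Finset.sum_filter_add_sum_filter_not Finset.univ (fun j => p ≤ lam j) f]
  congr 1
  refine Finset.sum_subset (fun j => by simp) fun j h1 h2 => hf j ?_
  simp only [Finset.mem_filter, Finset.mem_univ, true_and, not_le] at h1 h2
  by_contra h0
  exact h2 ⟨h0, h1⟩

theorem mul_sq_le_div (x : E) {l r p : ℝ} (hp : 0 < p) (hl : p ≤ l) (hr : N (l • x) ≤ r) :
    l * N x ^ 2 ≤ r ^ 2 / p := by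
  have hl0 : 0 < l := hp.trans_le hl
  rw [map_smul_eq_mul, Real.norm_of_nonneg hl0.le] at hr
  have h1 : (l * N x) ^ 2 ≤ r ^ 2 := pow_le_pow_left₀ (by positivity) hr 2
  rw [le_div_iff₀ hp]
  have : l * N x ^ 2 * p ≤ l * N x ^ 2 * l := mul_le_mul_of_nonneg_left hl (by positivity)
  linarith [mul_pow l (N x) 2, sq l]

theorem mul_div_smul_sq_le_div (x : E) {l r p : ℝ} (hp : 0 < p) (hr : N (l • x) ≤ r) :
    p * N ((l / p) • x) ^ 2 ≤ r ^ 2 / p := by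
  have e : (l / p) • x = p⁻¹ • l • x := by rw [smul_smul, div_eq_inv_mul]
  rw [e, map_smul_eq_mul, Real.norm_of_nonneg (by positivity)]
  have h1 : N (l • x) ^ 2 ≤ r ^ 2 := pow_le_pow_left₀ (apply_nonneg N _) hr 2
  calc p * (p⁻¹ * N (l • x)) ^ 2 = N (l • x) ^ 2 / p := by field_simp
    _ ≤ r ^ 2 / p := div_le_div_of_nonneg_right h1 hp.le

/-- A random point of `Co (range v)` with mean `x = ∑ j, lam j • v j`, small variance, and a small
probability of not being one of the `v j`. Here `t` is the sample space, `w` the weights, `Y` the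
point, and `s` an indicator that vanishes only where `Y` is some `v j`.

Call a nonzero `lam j` small if it is below the threshold `p`, large otherwise, and let `σ` be the
sum of the small coefficients. Choose independently a large index `J` with probability `lam J / (1 - σ)` and at most
one small index `L`, each with probability `p`. The point is `v J` if no `L` was chosen and
`(1 - θ) • v J + θ • v L` with `θ = lam L / p` otherwise. Each of the nonzero coefficients
contributes `O(r ^ 2 / p)` to the second moment: a large one because `lam j * N (v j) ^ 2 ≤ r ^ 2 / lam j`, a
small one because `N (θ • v j) ≤ r / p` occurs with probability `p`. Outcomes are pairs
`(J, L)`, with `L = none` if no small index was chosen. -/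
theorem exists_sparse_distribution {ι : Type*} [Fintype ι] (lam : ι → ℝ) (v : ι → E) {r p : ℝ}
    (hp : 0 < p) (hl : ∀ j, 0 ≤ lam j) (hl1 : ∑ j, lam j = 1)
    (hr : ∀ j, N (lam j • v j) ≤ r)
    (hkp : (Finset.card {j | lam j ≠ 0} : ℝ) * p ≤ 1 / 2) :
    ∃ (t : Finset (ι × Option ι)) (w : ι × Option ι → ℝ) (Y : ι × Option ι → E)
      (s : ι × Option ι → ℕ),
      (∀ q ∈ t, 0 ≤ w q) ∧ ∑ q ∈ t, w q = 1 ∧ ∑ q ∈ t, w q • Y q = ∑ j, lam j • v j ∧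
      (∀ q ∈ t, Y q ∈ convexHull ℝ (Set.range v)) ∧ (∀ q, s q = 0 → Y q ∈ Set.range v) ∧
      ∑ q ∈ t, w q * (s q : ℝ) ≤ Finset.card {j | lam j ≠ 0} * p ∧
      ∑ q ∈ t, w q * N (Y q - ∑ j, lam j • v j) ^ 2 ≤
        Finset.card {j | lam j ≠ 0} * (9 * r ^ 2 / p) := by
  classical
  set x := ∑ j, lam j • v j with hx
  set k : ℝ := (Finset.card {j | lam j ≠ 0} : ℝ) with hk
  have hk0 : 0 ≤ k := Nat.cast_nonneg _
  set Sm : Finset ι := {j | lam j ≠ 0 ∧ lam j < p} with hSm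
  set Bg : Finset ι := {j | p ≤ lam j} with hBg
  have memS : ∀ j ∈ Sm, lam j ≠ 0 ∧ lam j < p := fun j hj => by simpa [hSm] using hj
  have memB : ∀ j ∈ Bg, p ≤ lam j := fun j hj => by simpa [hBg] using hj
  have hcard : (Bg.card : ℝ) + Sm.card = k := by
    have := sum_threshold lam p (fun j => if lam j = 0 then (0 : ℝ) else 1) (by simp)
    rw [Finset.sum_congr rfl fun j hj => if_neg (hp.trans_le (memB j hj)).ne',
      Finset.sum_congr rfl fun j hj => if_neg (memS j hj).1] at this
    simpa [hk, Finset.sum_ite] using this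
  have hS0 : (0 : ℝ) ≤ Sm.card := Nat.cast_nonneg _
  have hB0 : (0 : ℝ) ≤ Bg.card := Nat.cast_nonneg _
  -- `σ` is the total small mass
  set σ := ∑ j ∈ Sm, lam j with hσ
  have hσ0 : 0 ≤ σ := Finset.sum_nonneg fun j _ => hl j
  have hσp : σ ≤ Sm.card * p := by
    rw [← nsmul_eq_mul]
    exact Finset.sum_le_card_nsmul _ _ _ fun j hj => (memS j hj).2.le
  have hSp : Sm.card * p ≤ 1 / 2 := by nlinarith
  have hσB : ∑ j ∈ Bg, lam j = 1 - σ := by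
    have := sum_threshold lam p lam (fun _ h => h)
    linarith
  have hσ1 : 1 / 2 ≤ 1 - σ := by linarith
  set a : ι → ℝ := fun j => lam j / (1 - σ) with ha
  have ha0 : ∀ j, 0 ≤ a j := fun j => div_nonneg (hl j) (by linarith)
  have ha1 : ∑ j ∈ Bg, a j = 1 := by
    rw [ha, ← Finset.sum_div, hσB, div_self (by linarith)]
  set O := Finset.insertNone Sm with hO
  set b : Option ι → ℝ := fun o => o.elim (1 - Sm.card * p) fun _ => p with hb
  have hb0 : ∀ o, 0 ≤ b o := by
    rintro (_ | o)
    · simp only [hb, Option.elim]; linarith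
    · exact hp.le
  have hb1 : ∑ o ∈ O, b o = 1 := by
    simp [hO, hb, Finset.sum_insertNone]
  set θ : Option ι → ℝ := fun o => o.elim 0 fun l => lam l / p with hθ
  set u : Option ι → E := fun o => o.elim 0 v with hu
  have hθ01 : ∀ o ∈ O, 0 ≤ θ o ∧ θ o ≤ 1 := by
    rintro (_ | o) ho
    · simp [hθ]
    · have := (memS o (Finset.some_mem_insertNone.1 ho)).2.le
      exact ⟨div_nonneg (hl o) hp.le, (div_le_one hp).2 this⟩
  have hbθ : ∑ o ∈ O, b o * (1 - θ o) = 1 - σ := by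
    simp only [mul_sub, mul_one, Finset.sum_sub_distrib, hb1]
    simp only [hO, hb, hθ, Finset.sum_insertNone, Option.elim, mul_zero, zero_add]
    rw [hσ]
    congr 1
    exact Finset.sum_congr rfl fun l _ => mul_div_cancel₀ _ hp.ne'
  set Y : ι × Option ι → E := fun q => (1 - θ q.2) • v q.1 + θ q.2 • u q.2 with hY
  set w : ι × Option ι → ℝ := fun q => a q.1 * b q.2 with hw
  have hw0 : ∀ q ∈ Bg ×ˢ O, 0 ≤ w q := fun q _ => mul_nonneg (ha0 _) (hb0 _)
  have avg_fst : ∀ g : ι → ℝ, ∑ q ∈ Bg ×ˢ O, w q * g q.1 = ∑ j ∈ Bg, a j * g j := fun g => by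
    simpa [hb1] using sum_product_smul Bg O a b g
  have avg_snd : ∀ g : Option ι → ℝ, ∑ q ∈ Bg ×ˢ O, w q * g q.2 = ∑ o ∈ O, b o * g o :=
    fun g => by simpa [ha1] using sum_product_smul' Bg O a b g
  have hw1 : ∑ q ∈ Bg ×ˢ O, w q = 1 := by simpa [ha1] using avg_fst fun _ => 1
  have hmean : ∑ q ∈ Bg ×ˢ O, w q • Y q = x := by
    have e1 : ∑ q ∈ Bg ×ˢ O, w q • Y q
        = ∑ q ∈ Bg ×ˢ O, (a q.1 * (b q.2 * (1 - θ q.2))) • v q.1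
          + ∑ q ∈ Bg ×ˢ O, (a q.1 * b q.2) • (θ q.2 • u q.2) := by
      rw [← Finset.sum_add_distrib]
      refine Finset.sum_congr rfl fun q _ => ?_
      simp only [hY, hw, smul_add, smul_smul, mul_assoc]
    rw [e1, sum_product_smul Bg O a (fun o => b o * (1 - θ o)) v,
      sum_product_smul' Bg O a b (fun o => θ o • u o), ha1, hbθ, one_smul,
      hx, ← sum_threshold lam p (fun j => lam j • v j) (fun j hj => by simp [hj]),
      Finset.smul_sum]
    congr 1
    · refine Finset.sum_congr rfl fun j _ => ?_
      rw [smul_smul, ha, mul_div_cancel₀ _ (by linarith)]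
    · simp only [hO, hb, hθ, hu, Finset.sum_insertNone, Option.elim, smul_zero, zero_add]
      refine Finset.sum_congr rfl fun j _ => ?_
      rw [smul_smul, mul_div_cancel₀ _ hp.ne']
  have hYmem : ∀ q ∈ Bg ×ˢ O, Y q ∈ convexHull ℝ (Set.range v) := by
    rintro ⟨j, o⟩ hq
    obtain ⟨h0, h1⟩ := hθ01 o (Finset.mem_product.1 hq).2
    have hv : ∀ j, v j ∈ convexHull ℝ (Set.range v) := fun j =>
      subset_convexHull ℝ _ ⟨j, rfl⟩
    rcases o with _ | l
    · simpa [hY, hθ] using hv j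
    · exact convex_convexHull ℝ _ (hv j) (hv l) (by linarith) h0 (by ring)
  set s : ι × Option ι → ℕ := fun q => q.2.elim 0 fun _ => 1 with hs
  have hsY : ∀ q, s q = 0 → Y q ∈ Set.range v := by
    rintro ⟨j, _ | l⟩ hq
    · simp [hY, hθ]
    · simp [hs] at hq
  have hs_avg : ∑ q ∈ Bg ×ˢ O, w q * (s q : ℝ) = Sm.card * p := by
    have := avg_snd (fun o => ((o.elim 0 fun _ => 1 : ℕ) : ℝ))
    rw [this]
    simp [hO, hb, Finset.sum_insertNone]
  have hr0 : 0 ≤ r := by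
    rcases isEmpty_or_nonempty ι with h | ⟨⟨j⟩⟩
    · simp at hl1
    · exact (apply_nonneg N _).trans (hr j)
  -- `x` is a sum of `k` vectors of norm at most `r`, and `k * p ≤ 1 / 2`
  have hNx : N x ^ 2 ≤ k * r ^ 2 / (2 * p) := by
    have h1 : N x ≤ k * r := by
      have h2 : N x ≤ ∑ j, N (lam j • v j) :=
        Finset.le_sum_of_subadditive N (map_zero N).le (map_add_le_add N) _ _
      rw [← sum_threshold lam p _ (fun j hj => by simp [hj])] at h2
      have h3 := Finset.sum_le_card_nsmul Bg (fun j => N (lam j • v j)) r fun j _ => hr j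
      have h4 := Finset.sum_le_card_nsmul Sm (fun j => N (lam j • v j)) r fun j _ => hr j
      rw [nsmul_eq_mul] at h3 h4
      rw [← hcard]
      linarith
    have h2 : N x ^ 2 ≤ (k * r) ^ 2 := pow_le_pow_left₀ (apply_nonneg N x) h1 2
    refine h2.trans ?_
    have h4 : k * r ^ 2 * (2 * (k * p)) ≤ k * r ^ 2 * 1 :=
      mul_le_mul_of_nonneg_left (by linarith) (by positivity)
    rw [le_div_iff₀ (by positivity)]
    linarith
  have hBavg : ∑ j ∈ Bg, a j * N (v j) ^ 2 ≤ Bg.card * (2 * r ^ 2 / p) := by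
    rw [← nsmul_eq_mul]
    refine Finset.sum_le_card_nsmul _ _ _ fun j hj => ?_
    have hj' := memB j hj
    have hj0 : 0 < lam j := hp.trans_le hj'
    have h2 : a j ≤ 2 * lam j := by
      rw [ha]
      simp only
      rw [div_le_iff₀ (by linarith)]
      nlinarith
    have h3 := mul_sq_le_div (v j) hp hj' (hr j)
    calc a j * N (v j) ^ 2 ≤ 2 * lam j * N (v j) ^ 2 :=
          mul_le_mul_of_nonneg_right h2 (sq_nonneg _)
      _ ≤ 2 * r ^ 2 / p := by rw [mul_div_assoc]; linarith
  have hSavg : ∑ o ∈ O, b o * N (θ o • u o) ^ 2 ≤ Sm.card * (r ^ 2 / p) := by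
    have e : ∑ o ∈ O, b o * N (θ o • u o) ^ 2
        = ∑ j ∈ Sm, p * N ((lam j / p) • v j) ^ 2 := by
      simp [hO, hb, hθ, hu, Finset.sum_insertNone]
    rw [e, ← nsmul_eq_mul]
    exact Finset.sum_le_card_nsmul _ _ _ fun j _ => mul_div_smul_sq_le_div (v j) hp (hr j)
  have hZ : ∑ q ∈ Bg ×ˢ O, w q * N (Y q - x) ^ 2 ≤ k * (9 * r ^ 2 / p) := by
    have h1 : ∀ q ∈ Bg ×ˢ O, w q * N (Y q - x) ^ 2 ≤
        3 * (w q * N (v q.1) ^ 2) + 3 * (w q * N (θ q.2 • u q.2) ^ 2) + w q * (3 * N x ^ 2) := by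
      intro q hq
      obtain ⟨h0, h1⟩ := hθ01 q.2 (Finset.mem_product.1 hq).2
      have h2 : N (Y q - x) ≤ N (v q.1) + N (θ q.2 • u q.2) + N x := by
        refine (map_sub_le_add N _ _).trans (add_le_add_left ?_ _)
        refine (map_add_le_add N _ _).trans (add_le_add_left ?_ _)
        rw [map_smul_eq_mul, Real.norm_of_nonneg (by linarith)]
        exact mul_le_of_le_one_left (apply_nonneg N _) (by linarith)
      have h3 : N (Y q - x) ^ 2 ≤ 3 * N (v q.1) ^ 2 + 3 * N (θ q.2 • u q.2) ^ 2 + 3 * N x ^ 2 := by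
        refine (pow_le_pow_left₀ (apply_nonneg N _) h2 2).trans ?_
        nlinarith [sq_nonneg (N (v q.1) - N (θ q.2 • u q.2)), sq_nonneg (N (v q.1) - N x),
          sq_nonneg (N (θ q.2 • u q.2) - N x)]
      have := mul_le_mul_of_nonneg_left h3 (hw0 q hq)
      linarith
    have h2 := Finset.sum_le_sum h1
    rw [Finset.sum_add_distrib, Finset.sum_add_distrib, ← Finset.mul_sum, ← Finset.mul_sum,
      ← Finset.sum_mul, hw1, avg_fst (fun j => N (v j) ^ 2),
      avg_snd (fun o => N (θ o • u o) ^ 2)] at h2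
    have e1 : Bg.card * (2 * r ^ 2 / p) = 2 * (Bg.card * (r ^ 2 / p)) := by ring
    have e2 : k * r ^ 2 / (2 * p) = k * (r ^ 2 / p) / 2 := by field_simp
    have e3 : k * (9 * r ^ 2 / p) = 9 * (k * (r ^ 2 / p)) := by ring
    have e4 : k * (r ^ 2 / p) = Bg.card * (r ^ 2 / p) + Sm.card * (r ^ 2 / p) := by
      rw [← hcard]; ring
    have e5 : 0 ≤ r ^ 2 / p := by positivity
    have e6 := mul_nonneg hS0 e5
    have e7 := mul_nonneg hB0 e5
    linarith
  refine ⟨Bg ×ˢ O, w, Y, s, hw0, hw1, hmean, hYmem, hsY, ?_, hZ⟩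
  rw [hs_avg]
  exact mul_le_mul_of_nonneg_right (by linarith) hp.le

/-- Derandomized form of `exists_sparse_distribution`: some outcome `Y` does at least as well as the
average in the potential `N ^ 2 + κ * s`. If the number of nonzero coefficients exceeds
`1 / (2 * p)`, leaving the point unchanged is cheap enough. -/
theorem exists_sparse_step
    (h : ∀ x y, N (x + y) ^ 2 + N (x - y) ^ 2 ≤ 2 * N x ^ 2 + 2 * D ^ 2 * N y ^ 2)
    {ι : Type*} [Fintype ι] (lam : ι → ℝ) (v : ι → E) {r p κ : ℝ}
    (hp : 0 < p) (hκ : 0 ≤ κ) (hl : ∀ j, 0 ≤ lam j) (hl1 : ∑ j, lam j = 1)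
    (hr : ∀ j, N (lam j • v j) ≤ r) (y : E) :
    ∃ Y ∈ convexHull ℝ (Set.range v), ∃ s : ℕ, (s = 0 → Y ∈ Set.range v) ∧
      N (y + (Y - ∑ j, lam j • v j)) ^ 2 + κ * s ≤
        N y ^ 2 + (Finset.card {j | lam j ≠ 0} : ℝ) * (18 * D ^ 2 * r ^ 2 / p + κ * (2 * p)) := by
  classical
  have hsum_mem : ∑ j, lam j • v j ∈ convexHull ℝ (Set.range v) :=
    (convex_convexHull ℝ _).sum_mem (fun j _ => hl j) hl1
      fun j _ => subset_convexHull ℝ _ ⟨j, rfl⟩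
  set x := ∑ j, lam j • v j with hx
  set k : ℝ := (Finset.card {j | lam j ≠ 0} : ℝ) with hk
  have hk0 : 0 ≤ k := Nat.cast_nonneg _
  have hsq : 0 ≤ 18 * D ^ 2 * r ^ 2 / p := by positivity
  by_cases hkp : 1 / 2 < k * p
  · refine ⟨x, hsum_mem, 1, by simp, ?_⟩
    simp only [sub_self, add_zero, Nat.cast_one, mul_one]
    nlinarith [mul_nonneg hk0 hsq]
  push Not at hkp
  obtain ⟨t, w, Y, s, hw0, hw1, hmean, hYmem, hsY, hs, hZ⟩ :=
    exists_sparse_distribution lam v hp hl hl1 hr hkp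
  rw [← hx] at hmean hZ
  rw [← hk] at hs hZ
  have hmain := sum_sq_add_le_of_mean_zero h t w (fun q => Y q - x) hw0 hw1
    (by simp only [smul_sub, Finset.sum_sub_distrib, hmean, ← Finset.sum_smul, hw1]; simp) y
  obtain ⟨q, hq, hle⟩ := exists_le_of_average_le t w
    (fun q => N (y + (Y q - x)) ^ 2 + κ * s q) hw0 hw1
    (N y ^ 2 + k * (18 * D ^ 2 * r ^ 2 / p + κ * (2 * p))) (by
      have e : ∑ q ∈ t, w q * (N (y + (Y q - x)) ^ 2 + κ * s q)
          = ∑ q ∈ t, w q * N (y + (Y q - x)) ^ 2 + κ * ∑ q ∈ t, w q * (s q : ℝ) := by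
        rw [Finset.mul_sum, ← Finset.sum_add_distrib]
        exact Finset.sum_congr rfl fun q _ => by ring
      rw [e]
      have e1 := mul_le_mul_of_nonneg_left hZ (by positivity : 0 ≤ 2 * D ^ 2)
      have e2 : 2 * D ^ 2 * (k * (9 * r ^ 2 / p)) = k * (18 * D ^ 2 * r ^ 2 / p) := by ring
      have e3 := mul_le_mul_of_nonneg_left hs hκ
      have e4 : 0 ≤ κ * (k * p) := by positivity
      linarith)
  exact ⟨Y q, hYmem q hq, s q, hsY q, hle⟩

end Smooth

/-! ### Rounding a sum -/

section Rounding

variable {E : Type*} [AddCommGroup E] [Module ℝ E] {N : Seminorm ℝ E} {D : ℝ}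

theorem exists_sparse_rounding_aux
    (h : ∀ x y, N (x + y) ^ 2 + N (x - y) ^ 2 ≤ 2 * N x ^ 2 + 2 * D ^ 2 * N y ^ 2)
    {α ι : Type*} [DecidableEq α] [Fintype ι] (F : Finset α) (lam : α → ι → ℝ) (v : α → ι → E)
    {r p κ : ℝ} (hp : 0 < p) (hκ : 0 ≤ κ) (hl : ∀ i j, 0 ≤ lam i j)
    (hl1 : ∀ i, ∑ j, lam i j = 1) (hr : ∀ i ∈ F, ∀ j, N (lam i j • v i j) ≤ r) :
    ∃ (Y : α → E) (S : Finset α), S ⊆ F ∧ (∀ i ∈ F, Y i ∈ convexHull ℝ (Set.range (v i))) ∧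
      (∀ i ∈ F, i ∉ S → Y i ∈ Set.range (v i)) ∧
      N (∑ i ∈ F, (Y i - ∑ j, lam i j • v i j)) ^ 2 + κ * S.card ≤
        ∑ i ∈ F, (Finset.card {j | lam i j ≠ 0} : ℝ) * (18 * D ^ 2 * r ^ 2 / p + κ * (2 * p)) := by
  induction F using Finset.induction_on with
  | empty => exact ⟨0, ∅, by simp⟩
  | insert a F ha ih =>
    obtain ⟨Y, S, hSF, hco, hmem, hle⟩ := ih fun i hi => hr i (Finset.mem_insert_of_mem hi)
    obtain ⟨z, hz, s, hs, hzle⟩ := exists_sparse_step h (lam a) (v a) hp hκ (hl a) (hl1 a)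
      (hr a (Finset.mem_insert_self a F)) (∑ i ∈ F, (Y i - ∑ j, lam i j • v i j))
    have hne : ∀ i ∈ F, i ≠ a := fun i hi e => ha (e ▸ hi)
    have hY : ∀ i ∈ F, Function.update Y a z i = Y i := fun i hi =>
      Function.update_of_ne (hne i hi) _ _
    refine ⟨Function.update Y a z, if s = 0 then S else insert a S, ?_, ?_, ?_, ?_⟩
    · split_ifs
      · exact hSF.trans (Finset.subset_insert _ _)
      · exact Finset.insert_subset_insert _ hSF
    · intro i hi
      rcases Finset.mem_insert.1 hi with rfl | hi
      · simpa using hz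
      · rw [hY i hi]; exact hco i hi
    · intro i hi hiS
      rcases Finset.mem_insert.1 hi with rfl | hi
      · by_cases h0 : s = 0
        · simpa using hs h0
        · simp [h0] at hiS
      · rw [hY i hi]
        refine hmem i hi fun hi' => hiS ?_
        split_ifs
        · exact hi'
        · exact Finset.mem_insert_of_mem hi'
    · rw [Finset.sum_insert ha, Finset.sum_insert ha, Function.update_self,
        Finset.sum_congr (s₁ := F) (g := fun i => Y i - ∑ j, lam i j • v i j) rfl
          fun i hi => by rw [hY i hi], add_comm (z - _)]
      have hcard : ((if s = 0 then S else insert a S).card : ℝ) ≤ S.card + s := by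
        split_ifs with h0
        · simp
        · have h1 := Finset.card_insert_le a S
          have h2 : 1 ≤ s := Nat.one_le_iff_ne_zero.2 h0
          exact_mod_cast h1.trans (by omega)
      have := mul_le_mul_of_nonneg_left hcard hκ
      linarith

/-- Independent rounding of the summands: at most `4 * p * K` of them stay outside `range (v i)`, at
the cost of a squared error of order `K * (D * r) ^ 2 / p`, where `K` bounds the total number of
nonzero coefficients. -/
theorem exists_sparse_rounding
    (h : ∀ x y, N (x + y) ^ 2 + N (x - y) ^ 2 ≤ 2 * N x ^ 2 + 2 * D ^ 2 * N y ^ 2)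
    {α ι : Type*} [DecidableEq α] [Fintype ι] (F : Finset α) (lam : α → ι → ℝ) (v : α → ι → E)
    {r p K : ℝ} (hD : 0 < D) (hr0 : 0 < r) (hp : 0 < p) (hl : ∀ i j, 0 ≤ lam i j)
    (hl1 : ∀ i, ∑ j, lam i j = 1) (hr : ∀ i ∈ F, ∀ j, N (lam i j • v i j) ≤ r)
    (hK : ∑ i ∈ F, (Finset.card {j | lam i j ≠ 0} : ℝ) ≤ K) :
    ∃ (Y : α → E) (S : Finset α), S ⊆ F ∧ (∀ i ∈ F, Y i ∈ convexHull ℝ (Set.range (v i))) ∧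
      (∀ i ∈ F, i ∉ S → Y i ∈ Set.range (v i)) ∧ (S.card : ℝ) ≤ 4 * p * K ∧
      N (∑ i ∈ F, (Y i - ∑ j, lam i j • v i j)) ^ 2 ≤ 36 * K * (D * r) ^ 2 / p := by
  -- this `κ` gives the two terms of the potential the same bound, up to a constant
  obtain ⟨Y, S, hSF, hco, hmem, hle⟩ := exists_sparse_rounding_aux h F lam v
    (κ := 9 * (D * r) ^ 2 / p ^ 2) hp (by positivity) hl hl1 hr
  have e : 18 * D ^ 2 * r ^ 2 / p + 9 * (D * r) ^ 2 / p ^ 2 * (2 * p)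
      = 36 * (D * r) ^ 2 / p := by field_simp; ring
  rw [e, ← Finset.sum_mul] at hle
  have hle' := hle.trans (mul_le_mul_of_nonneg_right hK (by positivity))
  refine ⟨Y, S, hSF, hco, hmem, ?_, ?_⟩
  · have h1 : 9 * (D * r) ^ 2 / p ^ 2 * S.card ≤ 9 * (D * r) ^ 2 / p ^ 2 * (4 * p * K) := by
      have : K * (36 * (D * r) ^ 2 / p) = 9 * (D * r) ^ 2 / p ^ 2 * (4 * p * K) := by
        field_simp; ring
      linarith [sq_nonneg (N (∑ i ∈ F, (Y i - ∑ j, lam i j • v i j)))]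
    exact le_of_mul_le_mul_left h1 (by positivity)
  · have h1 : 0 ≤ 9 * (D * r) ^ 2 / p ^ 2 * S.card := by positivity
    calc _ ≤ K * (36 * (D * r) ^ 2 / p) := by linarith
      _ = _ := by ring

/-- If each `x i - w i` lies in `V i` and each `x i + w i` in its convex hull, then half of the `x i`
can be moved into `V i`. Match the indices in pairs `{a, b}`; one of the pair moves into `V` by
`-w` and the other one is moved by `+w`, which changes the sum by `±(w b - w a)`. Smoothness provides
a sign that adds at most `D ^ 2 * N (w b - w a) ^ 2` to the squared error. -/
theorem exists_paired_rounding
    (h : ∀ x y, N (x + y) ^ 2 + N (x - y) ^ 2 ≤ 2 * N x ^ 2 + 2 * D ^ 2 * N y ^ 2)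
    {α : Type*} [DecidableEq α] (V : α → Set E) (x w : α → E) {ρ : ℝ} (m : ℕ) :
    ∀ P : Finset α, P.card = 2 * m → (∀ i ∈ P, x i - w i ∈ V i) →
      (∀ i ∈ P, x i + w i ∈ convexHull ℝ (V i)) → (∀ i ∈ P, N (w i) ≤ ρ) →
    ∃ (Y : α → E) (U : Finset α), U ⊆ P ∧ U.card = m ∧ (∀ i ∈ P, Y i ∈ convexHull ℝ (V i)) ∧
      (∀ i ∈ U, Y i ∈ V i) ∧ N (∑ i ∈ P, (Y i - x i)) ^ 2 ≤ m * (4 * (D * ρ) ^ 2) := by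
  induction m with
  | zero =>
    intro P hP _ _ _
    rw [mul_zero, Finset.card_eq_zero] at hP
    exact ⟨0, ∅, by simp [hP]⟩
  | succ m ih =>
    intro P hP hV hC hw
    obtain ⟨a, b, hab, habP⟩ : ∃ a b, a ≠ b ∧ {a, b} ⊆ P := by
      obtain ⟨Q, hQP, hQ⟩ := Finset.exists_subset_card_eq (s := P) (n := 2) (by omega)
      obtain ⟨a, b, hab, rfl⟩ := Finset.card_eq_two.1 hQ
      exact ⟨a, b, hab, hQP⟩
    have haP : a ∈ P := habP (by simp)
    have hbP : b ∈ P := habP (by simp)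
    set P' := P \ {a, b} with hP'
    have hsub : P' ⊆ P := Finset.sdiff_subset
    have hcard : P'.card = 2 * m := by
      rw [hP', Finset.card_sdiff_of_subset habP, hP, Finset.card_pair hab]; omega
    obtain ⟨Y, U, hUP, hUc, hYC, hYV, hle⟩ := ih P' hcard (fun i hi => hV i (hsub hi))
      (fun i hi => hC i (hsub hi)) (fun i hi => hw i (hsub hi))
    have haP' : a ∉ P' := by simp [hP']
    have hbP' : b ∉ P' := by simp [hP']
    -- it is enough to round one of `a`, `b` to `V` with the right sign
    have key : ∀ a b, a ≠ b → a ∈ P → b ∈ P → a ∉ P' → b ∉ P' → P = insert a (insert b P') →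
        N ((∑ i ∈ P', (Y i - x i)) + (w b - w a)) ^ 2
          ≤ N (∑ i ∈ P', (Y i - x i)) ^ 2 + D ^ 2 * N (w b - w a) ^ 2 →
        ∃ (Y : α → E) (U : Finset α), U ⊆ P ∧ U.card = m + 1 ∧
          (∀ i ∈ P, Y i ∈ convexHull ℝ (V i)) ∧ (∀ i ∈ U, Y i ∈ V i) ∧
          N (∑ i ∈ P, (Y i - x i)) ^ 2 ≤ (m + 1 : ℕ) * (4 * (D * ρ) ^ 2) := by
      intro a b hab haP hbP ha hb hPe hN
      set Z : α → E := fun i => if i = a then x a - w a else if i = b then x b + w b else Y i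
        with hZ
      have hZa : Z a = x a - w a := if_pos rfl
      have hZb : Z b = x b + w b := by simp [hZ, hab.symm]
      have hZ' : ∀ i ∈ P', Z i = Y i := fun i hi => by
        have h1 : i ≠ a := fun e => ha (e ▸ hi)
        have h2 : i ≠ b := fun e => hb (e ▸ hi)
        simp [hZ, h1, h2]
      have haU : a ∉ U := fun hh => ha (hUP hh)
      refine ⟨Z, insert a U, ?_, ?_, ?_, ?_, ?_⟩
      · exact Finset.insert_subset haP (hUP.trans hsub)
      · rw [Finset.card_insert_of_notMem haU, hUc]
      · intro i hi
        rw [hPe, Finset.mem_insert, Finset.mem_insert] at hi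
        rcases hi with rfl | rfl | hi
        · rw [hZa]; exact subset_convexHull ℝ _ (hV _ haP)
        · rw [hZb]; exact hC _ hbP
        · rw [hZ' i hi]; exact hYC i hi
      · intro i hi
        rcases Finset.mem_insert.1 hi with rfl | hi
        · rw [hZa]; exact hV _ haP
        · rw [hZ' i (hUP hi)]; exact hYV i hi
      · have e : ∑ i ∈ P, (Z i - x i) = (∑ i ∈ P', (Y i - x i)) + (w b - w a) := by
          rw [hPe, Finset.sum_insert (by simp [hab, ha]), Finset.sum_insert hb, hZa, hZb,
            Finset.sum_congr rfl fun i hi => by rw [hZ' i hi]]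
          abel
        rw [e]
        have h1 : N (w b - w a) ≤ 2 * ρ :=
          (map_sub_le_add N _ _).trans (by linarith [hw a haP, hw b hbP])
        have h2 : N (w b - w a) ^ 2 ≤ (2 * ρ) ^ 2 := pow_le_pow_left₀ (apply_nonneg N _) h1 2
        have h3 := mul_le_mul_of_nonneg_left h2 (sq_nonneg D)
        push_cast
        linarith [mul_pow D ρ 2, mul_pow 2 ρ 2]
    have hPe : P = insert a (insert b P') := by
      ext i
      simp only [hP', Finset.mem_insert, Finset.mem_sdiff, Finset.mem_singleton]
      constructor
      · intro hi
        tauto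
      · rintro (rfl | rfl | hi)
        · exact haP
        · exact hbP
        · exact hi.1
    rcases exists_sign_sq_le h (∑ i ∈ P', (Y i - x i)) (w b - w a) with h1 | h1
    · exact key a b hab haP hbP haP' hbP' hPe h1
    · refine key b a hab.symm hbP haP hbP' haP' (hPe.trans (Finset.insert_comm _ _ _)) ?_
      rw [sub_eq_add_neg, neg_sub] at h1
      rwa [map_sub_rev N (w a)]

/-- A convex combination of two points: the displacement `-w` to the point with the larger weight is
short, and the opposite displacement stays in the segment. -/
theorem exists_reflection {ι : Type*} [Fintype ι] (lam : ι → ℝ) (v : ι → E) {r : ℝ}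
    (hl : ∀ j, 0 ≤ lam j) (hl1 : ∑ j, lam j = 1) (hr : ∀ j, N (lam j • v j) ≤ r)
    (hk : Finset.card {j | lam j ≠ 0} = 2) :
    ∃ w : E, (∑ j, lam j • v j) - w ∈ Set.range v ∧
      (∑ j, lam j • v j) + w ∈ convexHull ℝ (Set.range v) ∧ N w ≤ 2 * r := by
  classical
  obtain ⟨a, b, hab, hsupp⟩ := Finset.card_eq_two.1 hk
  have key : ∀ a b, a ≠ b → ({j | lam j ≠ 0} : Finset ι) = {a, b} → lam b ≤ lam a →
      ∃ w : E, (∑ j, lam j • v j) - w ∈ Set.range v ∧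
        (∑ j, lam j • v j) + w ∈ convexHull ℝ (Set.range v) ∧ N w ≤ 2 * r := by
    intro a b hab hsupp hle
    have hz : ∀ j, j ∉ ({a, b} : Finset ι) → lam j = 0 := fun j hj => by
      rw [← hsupp] at hj; simpa using hj
    have hx : ∑ j, lam j • v j = lam a • v a + lam b • v b := by
      rw [← Finset.sum_pair (f := fun j => lam j • v j) hab]
      exact (Finset.sum_subset (Finset.subset_univ _) fun j _ hj => by simp [hz j hj]).symm
    have h1 : lam a + lam b = 1 := by
      rw [← hl1, ← Finset.sum_pair hab]
      exact Finset.sum_subset (Finset.subset_univ _) fun j _ hj => hz j hj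
    have hv : ∀ j, v j ∈ convexHull ℝ (Set.range v) := fun j => subset_convexHull ℝ _ ⟨j, rfl⟩
    refine ⟨lam b • v b - lam b • v a, ⟨a, ?_⟩, ?_, ?_⟩
    · rw [hx]
      have : v a = (lam a + lam b) • v a := by rw [h1, one_smul]
      nth_rw 1 [this]
      module
    · have e : (∑ j, lam j • v j) + (lam b • v b - lam b • v a)
          = (lam a - lam b) • v a + (2 * lam b) • v b := by rw [hx]; module
      rw [e]
      exact convex_convexHull ℝ _ (hv a) (hv b) (by linarith) (by linarith [hl b]) (by linarith)
    · have h2 : N (lam b • v a) ≤ N (lam a • v a) := by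
        rw [map_smul_eq_mul, map_smul_eq_mul, Real.norm_of_nonneg (hl a),
          Real.norm_of_nonneg (hl b)]
        exact mul_le_mul_of_nonneg_right hle (apply_nonneg N _)
      refine (map_sub_le_add N _ _).trans ?_
      linarith [hr a, hr b]
  rcases le_total (lam b) (lam a) with hle | hle
  · exact key a b hab hsupp hle
  · exact key b a hab.symm (hsupp.trans (Finset.pair_comm _ _)) hle

end Rounding

/-! ### Bounds for the sample size -/

section Arithmetic

variable {d q δ k : ℝ}

/-- If `q` is at most `3 * d / 5`, then `q ^ 3 = O(δ ^ 2 * d ^ 2)` makes the sample size at least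
`2 * q`. -/
theorem two_mul_le_sample_bound (hq : 0 < q) (hqd : 5 * q ≤ 3 * d)
    (h : q ^ 3 ≤ 50000 * (δ ^ 2 * d ^ 2)) :
    2 * q ≤ 1 + (d + q) *
      (10 ^ 6 * ((d + q) * δ ^ 2 / q ^ 2) / (1 + 10 ^ 6 * ((d + q) * δ ^ 2 / q ^ 2))) := by
  have hd : 0 < d := by linarith
  set a := 10 ^ 6 * ((d + q) * δ ^ 2 / q ^ 2) with ha
  have ha0 : 0 ≤ a := by positivity
  have h1 : 5 * q ≤ a * d := by
    have e : a * d = 10 ^ 6 * (d + q) * δ ^ 2 * d / q ^ 2 := by rw [ha]; ring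
    rw [e, le_div_iff₀ (by positivity)]
    have : 0 ≤ q * δ ^ 2 * d := by positivity
    nlinarith
  have h2 : 2 * q ≤ a * (d - q) := by nlinarith
  have h3 : 2 * q ≤ (d + q) * (a / (1 + a)) := by
    rw [← mul_div_assoc, le_div_iff₀ (by positivity)]
    linarith
  linarith

/-- If `a = N / η` with `N = d + q`, then `N * a / (1 + a) = N ^ 2 / (N + η) ≥ N - η`. -/
theorem add_le_sample_bound (hq : 0 < q) (hd : 0 ≤ d) (hδ : 0 < δ)
    (h : k + q ^ 2 / (10 ^ 6 * δ ^ 2) ≤ d + 1) :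
    k + q ≤ 1 + (d + q) *
      (10 ^ 6 * ((d + q) * δ ^ 2 / q ^ 2) / (1 + 10 ^ 6 * ((d + q) * δ ^ 2 / q ^ 2))) := by
  set η := q ^ 2 / (10 ^ 6 * δ ^ 2) with hη
  have hη0 : 0 < η := by positivity
  have e : 10 ^ 6 * ((d + q) * δ ^ 2 / q ^ 2) = (d + q) / η := by rw [hη]; field_simp
  have hN : 0 < d + q := by linarith
  have e2 : (d + q) * ((d + q) / η / (1 + (d + q) / η)) = (d + q) ^ 2 / (η + (d + q)) := by
    field_simp
  have h1 : d + q - η ≤ (d + q) ^ 2 / (η + (d + q)) := by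
    rw [le_div_iff₀ (by positivity)]
    nlinarith
  rw [e, e2]
  linarith

end Arithmetic

/-! ### Choice of the rounding -/

section Rounding

variable {E : Type*} [AddCommGroup E] [Module ℝ E] {N : Seminorm ℝ E} {D : ℝ}

/-- The rounding of the summands with a fractional coefficient. Here `δ` stands for `R / ε`, and `S` is
the set of summands that remain outside `range (v i)`. -/
theorem exists_rounding
    (h : ∀ x y, N (x + y) ^ 2 + N (x - y) ^ 2 ≤ 2 * N x ^ 2 + 2 * D ^ 2 * N y ^ 2)
    {α ι : Type*} [DecidableEq α] [Fintype ι] (F : Finset α) (lam : α → ι → ℝ) (v : α → ι → E)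
    (d : ℕ) {r δ : ℝ} (hD : 0 < D) (hr0 : 0 < r) (hδ : 0 < δ) (hl : ∀ i j, 0 ≤ lam i j)
    (hl1 : ∀ i, ∑ j, lam i j = 1) (hr : ∀ i ∈ F, ∀ j, N (lam i j • v i j) ≤ r)
    (hk : ∀ i ∈ F, 2 ≤ Finset.card {j | lam i j ≠ 0})
    (hK : ∑ i ∈ F, Finset.card {j | lam i j ≠ 0} ≤ d + F.card) (hF : 1 ≤ F.card) :
    ∃ (Y : α → E) (S : Finset α) (q : ℕ), S ⊆ F ∧ S.card ≤ q ∧ 1 ≤ q ∧ q ≤ F.card ∧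
      (∀ i ∈ F, Y i ∈ convexHull ℝ (Set.range (v i))) ∧
      (∀ i ∈ F, i ∉ S → Y i ∈ Set.range (v i)) ∧
      δ * N (∑ i ∈ F, (Y i - ∑ j, lam i j • v i j)) ≤ q * (D * r) ∧
      (S.card : ℝ) + q ≤ 1 + ((d : ℝ) + q) *
        (10 ^ 6 * (((d : ℝ) + q) * δ ^ 2 / q ^ 2) /
          (1 + 10 ^ 6 * (((d : ℝ) + q) * δ ^ 2 / q ^ 2))) := by
  have hFd : F.card ≤ d := by
    have := Finset.card_nsmul_le_sum F _ _ hk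
    rw [smul_eq_mul] at this
    omega
  have hd : (1 : ℝ) ≤ d := by exact_mod_cast hF.trans hFd
  have hFd' : (F.card : ℝ) ≤ d := by exact_mod_cast hFd
  have hF' : (1 : ℝ) ≤ F.card := by exact_mod_cast hF
  have hDr : 0 < D * r := mul_pos hD hr0
  have hx : ∀ i, ∑ j, lam i j • v i j ∈ convexHull ℝ (Set.range (v i)) := fun i =>
    (convex_convexHull ℝ _).sum_mem (fun j _ => hl i j) (hl1 i)
      fun j _ => subset_convexHull ℝ _ ⟨j, rfl⟩
  -- Independent rounding with threshold `p = q / (16 * d)`, which leaves at most `q / 2` indices.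
  have low : ∀ q : ℕ, 1 ≤ q → 1152 * (δ ^ 2 * d ^ 2) ≤ (q : ℝ) ^ 3 →
      ∃ (Y : α → E) (S : Finset α), S ⊆ F ∧ 2 * S.card ≤ q ∧
        (∀ i ∈ F, Y i ∈ convexHull ℝ (Set.range (v i))) ∧
        (∀ i ∈ F, i ∉ S → Y i ∈ Set.range (v i)) ∧
        δ * N (∑ i ∈ F, (Y i - ∑ j, lam i j • v i j)) ≤ q * (D * r) := by
    intro q hq hqδ
    have hq' : (1 : ℝ) ≤ q := by exact_mod_cast hq
    obtain ⟨Y, S, hSF, hco, hmem, hS, herr⟩ := exists_sparse_rounding h F lam v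
      (p := q / (16 * d)) (K := 2 * d) hD hr0 (by positivity) hl hl1 hr (by
        have : (∑ i ∈ F, Finset.card {j | lam i j ≠ 0} : ℝ) ≤ d + F.card := by exact_mod_cast hK
        linarith)
    refine ⟨Y, S, hSF, ?_, hco, hmem, ?_⟩
    · have e : 4 * ((q : ℝ) / (16 * d)) * (2 * d) = q / 2 := by field_simp; norm_num
      rw [e] at hS
      have : 2 * (S.card : ℝ) ≤ q := by linarith
      exact_mod_cast this
    · refine le_of_sq_le_sq ?_ (by positivity)
      have e : 36 * (2 * d) * (D * r) ^ 2 / ((q : ℝ) / (16 * d))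
          = 1152 * d ^ 2 * (D * r) ^ 2 / q := by field_simp; norm_num
      rw [e] at herr
      have h1 := mul_le_mul_of_nonneg_left herr (sq_nonneg δ)
      rw [← mul_pow] at h1
      refine h1.trans ?_
      rw [← mul_div_assoc, div_le_iff₀ (by positivity)]
      have := mul_le_mul_of_nonneg_right hqδ (sq_nonneg (D * r))
      linarith [mul_pow (q : ℝ) (D * r) 2]
  -- No rounding at all: `S = F` and `q = |F|`.
  have full : (F.card : ℝ) + F.card ≤ 1 + ((d : ℝ) + F.card) *
        (10 ^ 6 * (((d : ℝ) + F.card) * δ ^ 2 / F.card ^ 2) /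
          (1 + 10 ^ 6 * (((d : ℝ) + F.card) * δ ^ 2 / F.card ^ 2))) →
      ∃ (Y : α → E) (S : Finset α) (q : ℕ), S ⊆ F ∧ S.card ≤ q ∧ 1 ≤ q ∧ q ≤ F.card ∧
      (∀ i ∈ F, Y i ∈ convexHull ℝ (Set.range (v i))) ∧
      (∀ i ∈ F, i ∉ S → Y i ∈ Set.range (v i)) ∧
      δ * N (∑ i ∈ F, (Y i - ∑ j, lam i j • v i j)) ≤ q * (D * r) ∧
      (S.card : ℝ) + q ≤ 1 + ((d : ℝ) + q) *
        (10 ^ 6 * (((d : ℝ) + q) * δ ^ 2 / q ^ 2) /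
          (1 + 10 ^ 6 * (((d : ℝ) + q) * δ ^ 2 / q ^ 2))) := fun hle =>
    ⟨fun i => ∑ j, lam i j • v i j, F, F.card, subset_rfl, le_rfl, hF, le_rfl,
      fun i _ => hx i, fun i h1 h2 => absurd h1 h2, by simp; positivity, hle⟩
  have hex : ∃ q : ℕ, 1 ≤ q ∧ 1152 * (δ ^ 2 * d ^ 2) ≤ (q : ℝ) ^ 3 := by
    obtain ⟨q, hq⟩ := exists_nat_ge (1152 * (δ ^ 2 * d ^ 2) + 1)
    have hpos : 0 ≤ 1152 * (δ ^ 2 * (d : ℝ) ^ 2) := by positivity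
    have hq1 : (1 : ℝ) ≤ q := le_trans (by linarith) hq
    refine ⟨q, by exact_mod_cast hq1, ?_⟩
    linarith [le_self_pow₀ hq1 (n := 3) (by norm_num)]
  classical
  -- the least `q` for which independent rounding meets the error bound
  set q := Nat.find hex with hqdef
  obtain ⟨hq1, hq3⟩ := Nat.find_spec hex
  rw [← hqdef] at hq1 hq3
  rcases eq_or_lt_of_le hq1 with hq | hq
  -- for `q = 1` the bound `2 * |S| ≤ q` gives `S = ∅`, and the sample size is at least `1`
  · obtain ⟨Y, S, hSF, hS, hco, hmem, herr⟩ := low q hq1 hq3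
    refine ⟨Y, S, q, hSF, by omega, hq1, hq ▸ hF, hco, hmem, herr, ?_⟩
    have hS0 : S.card = 0 := by omega
    rw [hS0, ← hq, Nat.cast_zero, Nat.cast_one, zero_add]
    exact le_add_of_nonneg_right (by positivity)
  have hmin : ((q : ℝ) - 1) ^ 3 < 1152 * (δ ^ 2 * d ^ 2) := by
    have := Nat.find_min hex (m := q - 1) (by omega)
    push Not at this
    have := this (by omega)
    rwa [Nat.cast_sub hq1, Nat.cast_one] at this
  have hq2 : (2 : ℝ) ≤ q := by exact_mod_cast hq
  have hδd : 0 < δ ^ 2 * (d : ℝ) ^ 2 := by positivity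
  by_cases hlow : q ≤ F.card ∧ 5 * q ≤ 3 * d
  · obtain ⟨Y, S, hSF, hS, hco, hmem, herr⟩ := low q hq1 hq3
    refine ⟨Y, S, q, hSF, by omega, hq1, hlow.1, hco, hmem, herr, ?_⟩
    have h1 : (S.card : ℝ) ≤ q := by exact_mod_cast (by omega : S.card ≤ q)
    have h2 : (q : ℝ) ^ 3 ≤ 50000 * (δ ^ 2 * d ^ 2) := by
      have : ((q : ℝ) / 2) ^ 3 ≤ (q - 1) ^ 3 := pow_le_pow_left₀ (by positivity) (by linarith) 3
      have e : ((q : ℝ) / 2) ^ 3 = q ^ 3 / 8 := by ring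
      linarith
    have := two_mul_le_sample_bound (d := d) (q := q) (by linarith)
      (by exact_mod_cast hlow.2) h2
    linarith
  -- Otherwise `δ` is so large that `q = |F|` leaves room for most of `F`.
  have hcube : (F.card : ℝ) ^ 3 ≤ 50000 * (δ ^ 2 * d ^ 2) := by
    rw [not_and_or] at hlow
    rcases hlow with hlow | hlow
    · have h1 : (F.card : ℝ) ≤ q - 1 := by
        have : F.card + 1 ≤ q := by omega
        have : (F.card : ℝ) + 1 ≤ q := by exact_mod_cast this
        linarith
      have := pow_le_pow_left₀ (by linarith) h1 3
      linarith
    · have h0 : (3 : ℝ) * d < 5 * q := by exact_mod_cast not_le.1 hlow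
      have h1 : (3 / 10 : ℝ) * F.card ≤ q - 1 := by linarith
      have := pow_le_pow_left₀ (by linarith) h1 3
      have e : ((3 / 10 : ℝ) * F.card) ^ 3 = 27 / 1000 * (F.card : ℝ) ^ 3 := by ring
      linarith
  by_cases hsmall : 5 * F.card ≤ 3 * d
  · have := two_mul_le_sample_bound (d := d) (q := F.card) (by linarith)
      (by exact_mod_cast hsmall) hcube
    exact full (by linarith)
  have hbig : (3 : ℝ) * d < 5 * F.card := by exact_mod_cast not_le.1 hsmall
  set η := (F.card : ℝ) ^ 2 / (10 ^ 6 * δ ^ 2) with hη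
  have hη0 : 0 < η := by positivity
  have hηd : η ≤ d / 10 := by
    rw [hη, div_le_iff₀ (by positivity)]
    have h1 : (F.card : ℝ) * F.card ^ 2 ≤ F.card * (d / 10 * (10 ^ 6 * δ ^ 2)) := by
      have : (3 / 5 * d : ℝ) * (d * δ ^ 2) ≤ F.card * (d * δ ^ 2) :=
        mul_le_mul_of_nonneg_right (by linarith) (by positivity)
      nlinarith
    exact le_of_mul_le_mul_left h1 (by linarith)
  -- `m` indices have to be removed from `S`
  set m := ⌈η - 1⌉₊ with hm
  have hm1 : η ≤ m + 1 := by linarith [Nat.le_ceil (η - 1)]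
  have hm2 : (m : ℝ) ≤ η := by
    rcases le_or_gt 0 (η - 1) with h0 | h0
    · linarith [Nat.ceil_lt_add_one h0]
    · rw [hm, Nat.ceil_eq_zero.2 h0.le]; simpa using hη0.le
  set A := F.filter fun i => Finset.card {j | lam i j ≠ 0} = 2 with hA
  rcases le_or_gt (2 * m) A.card with hmA | hmA
  · obtain ⟨P, hPA, hPc⟩ := Finset.exists_subset_card_eq hmA
    have hPF : P ⊆ F := hPA.trans (Finset.filter_subset _ _)
    have hw : ∀ i, ∃ w : E, i ∈ P → (∑ j, lam i j • v i j) - w ∈ Set.range (v i) ∧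
        (∑ j, lam i j • v i j) + w ∈ convexHull ℝ (Set.range (v i)) ∧ N w ≤ 2 * r := by
      intro i
      by_cases hi : i ∈ P
      · obtain ⟨w, hw⟩ := exists_reflection (lam i) (v i) (hl i) (hl1 i) (hr i (hPF hi))
          (Finset.mem_filter.1 (hPA hi)).2
        exact ⟨w, fun _ => hw⟩
      · exact ⟨0, fun h => absurd h hi⟩
    choose w hw using hw
    obtain ⟨Y, U, hUP, hUc, hco, hmem, herr⟩ := exists_paired_rounding h
      (fun i => Set.range (v i)) (fun i => ∑ j, lam i j • v i j) w m P hPc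
      (fun i hi => (hw i hi).1) (fun i hi => (hw i hi).2.1) (fun i hi => (hw i hi).2.2)
    have hUF : U ⊆ F := hUP.trans hPF
    refine ⟨fun i => if i ∈ P then Y i else ∑ j, lam i j • v i j, F \ U, F.card,
      Finset.sdiff_subset, Finset.card_le_card Finset.sdiff_subset, hF, le_rfl, ?_, ?_, ?_, ?_⟩
    · intro i _
      dsimp only
      split_ifs with hi
      · exact hco i hi
      · exact hx i
    · intro i hi hiU
      have hiU' : i ∈ U := by
        by_contra h0
        exact hiU (Finset.mem_sdiff.2 ⟨hi, h0⟩)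
      simp only [hUP hiU', if_true]
      exact hmem i hiU'
    · have e : ∑ i ∈ F, ((if i ∈ P then Y i else ∑ j, lam i j • v i j) - ∑ j, lam i j • v i j)
          = ∑ i ∈ P, (Y i - ∑ j, lam i j • v i j) := by
        rw [← Finset.sum_subset hPF fun i _ hi => by simp [hi]]
        exact Finset.sum_congr rfl fun i hi => by simp [hi]
      rw [e]
      refine le_of_sq_le_sq ?_ (by positivity)
      have h1 := mul_le_mul_of_nonneg_left herr (sq_nonneg δ)
      rw [← mul_pow] at h1
      refine h1.trans ?_
      have h2 : δ ^ 2 * m ≤ (F.card : ℝ) ^ 2 / 10 ^ 6 := by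
        have := mul_le_mul_of_nonneg_left hm2 (sq_nonneg δ)
        have e2 : δ ^ 2 * η = (F.card : ℝ) ^ 2 / 10 ^ 6 := by rw [hη]; field_simp
        linarith
      have h3 := mul_le_mul_of_nonneg_right h2 (sq_nonneg (D * r))
      have h4 : 0 ≤ (F.card : ℝ) ^ 2 * (D * r) ^ 2 := by positivity
      nlinarith
    · refine add_le_sample_bound (by linarith) (by linarith) hδ ?_
      rw [← hη, Finset.cast_card_sdiff hUF, hUc]
      linarith
  · refine full (add_le_sample_bound (by linarith) (by linarith) hδ ?_)
    rw [← hη]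
    -- with few two-point indices, `∑ k i ≤ d + |F|` forces `|F|` well below `d`
    have h1 : 3 * F.card ≤ ∑ i ∈ F, Finset.card {j | lam i j ≠ 0} + A.card := by
      rw [hA, Finset.card_filter, ← Finset.sum_add_distrib, mul_comm, ← smul_eq_mul]
      refine Finset.card_nsmul_le_sum _ _ _ fun i hi => ?_
      have := hk i hi
      split_ifs <;> omega
    have h2 : 2 * (F.card : ℝ) ≤ d + 2 * m := by
      have : 2 * F.card ≤ d + 2 * m := by omega
      exact_mod_cast this
    linarith

end Rounding

end ApproxSF

/-! ### The approximate Shapley–Folkman theorem -/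

theorem mainTheorem1 :
    ∃ c : ℝ, 0 < c ∧
      ∀ (d n : ℕ) (N : Seminorm ℝ (Fin d → ℝ)) (D : ℝ)
        (ε β γ : ℝ) (V : Fin n → Set (Fin d → ℝ))
        (lam : Fin n → Fin (d + 1) → ℝ) (v : Fin n → Fin (d + 1) → (Fin d → ℝ))
        (x : Fin d → ℝ),
        ApproxSF.IsNorm N → ApproxSF.IsTwoSmooth N D →
        0 < ε → 0 < β → 0 < γ →
        (∀ i j, v i j ∈ V i) →
        (∀ i j, 0 ≤ lam i j) → (∀ i, ∑ j, lam i j = 1) →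
        {p : Fin n × Fin (d + 1) | lam p.1 p.2 ≠ 0}.ncard ≤ n + d →
        x = ∑ i, ∑ j, lam i j • v i j →
        ∃ (xhat : Fin d → ℝ) (μ : Fin n → ℝ) (S T : Finset (Fin n)) (q : ℕ),
          (∀ i, 0 ≤ μ i) ∧ Disjoint S T ∧ q = S.card + T.card ∧ q ≤ d ∧
          xhat ∈ (∑ i ∈ (S ∪ T)ᶜ, V i) + (∑ i ∈ T, μ i • V i) +
            (∑ i ∈ S, μ i • convexHull ℝ (V i)) ∧
          N (x - xhat) ≤ q / β * ε ∧
          |(∑ i ∈ S ∪ T, μ i) - q| ≤ q * ε ∧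
          √(∑ i ∈ S ∪ T, (μ i - 1) ^ 2) ≤ q / γ * ε ∧
          (S.card : ℝ) ≤
            (ApproxSF.sampleSize c (ApproxSF.radius N D β γ lam v) ε d q - T.card) / 2 ∧
          (S.card : ℝ) ≤
            ApproxSF.sampleSize c (ApproxSF.radius N D β γ lam v) ε d q - q := by
  refine ⟨10 ^ 6, by norm_num, ?_⟩
  intro d n N D ε β γ V lam v x _ hsm hε hβ hγ hvV hl hl1 hcount hx
  obtain ⟨hD, h⟩ := hsm
  set R := ApproxSF.radius N D β γ lam v with hR
  -- It suffices to find a rounding with all `μ i` equal to `1`; then `T` is only used to bring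
  -- `|S| + |T|` up to `q`.
  suffices hmain : ∃ (Y : Fin n → Fin d → ℝ) (S F : Finset (Fin n)) (q : ℕ), S ⊆ F ∧
      S.card ≤ q ∧ q ≤ F.card ∧ F.card ≤ d ∧ (∀ i, Y i ∈ convexHull ℝ (V i)) ∧
      (∀ i, i ∉ S → Y i ∈ V i) ∧ N (x - ∑ i, Y i) ≤ q / β * ε ∧
      (S.card : ℝ) + q ≤ ApproxSF.sampleSize (10 ^ 6) R ε d q by
    obtain ⟨Y, S, F, q, hSF, hSq, hqF, hFd, hco, hmem, herr, hm⟩ := hmain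
    obtain ⟨T, hTF, hTc⟩ := Finset.exists_subset_card_eq (s := F \ S) (n := q - S.card) (by
      rw [Finset.card_sdiff_of_subset hSF]; omega)
    have hdisj : Disjoint S T := by
      rw [Finset.disjoint_left]
      exact fun i hi hT => (Finset.mem_sdiff.1 (hTF hT)).2 hi
    have hqST : q = S.card + T.card := by omega
    have hqR : (q : ℝ) = S.card + T.card := by exact_mod_cast hqST
    have hq0 : (0 : ℝ) ≤ q := Nat.cast_nonneg _
    refine ⟨∑ i, Y i, fun _ => 1, S, T, q, fun _ => zero_le_one, hdisj, hqST, by omega, ?_, herr,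
      ?_, ?_, ?_, ?_⟩
    · simp only [one_smul]
      rw [← Finset.sum_compl_add_sum (S ∪ T), Finset.sum_union hdisj, add_comm (∑ i ∈ S, Y i),
        ← add_assoc]
      refine Set.add_mem_add (Set.add_mem_add ?_ ?_) ?_
      · refine Set.finsetSum_mem_finsetSum _ _ _ fun i hi => hmem i fun hS => ?_
        exact Finset.mem_compl.1 hi (Finset.mem_union_left _ hS)
      · exact Set.finsetSum_mem_finsetSum _ _ _ fun i hi => hmem i fun hS =>
          Finset.disjoint_left.1 hdisj hS hi
      · exact Set.finsetSum_mem_finsetSum _ _ _ fun i _ => hco i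
    · rw [Finset.sum_const, Finset.card_union_of_disjoint hdisj, ← hqST]
      simp only [nsmul_eq_mul, mul_one, sub_self, abs_zero]
      positivity
    · simp only [sub_self, ne_eq, OfNat.ofNat_ne_zero, not_false_eq_true, zero_pow,
        Finset.sum_const_zero, Real.sqrt_zero]
      positivity
    · rw [le_div_iff₀ two_pos]
      linarith only [hm, hqR]
    · linarith only [hm]
  -- the indices with a fractional coefficient; each has at least two nonzero coefficients
  set F : Finset (Fin n) := {i | ∀ j, lam i j ≠ 1} with hF
  have hkpos : ∀ i, 1 ≤ Finset.card {j | lam i j ≠ 0} := by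
    intro i
    rw [Nat.one_le_iff_ne_zero, Finset.card_ne_zero]
    by_contra hempty
    have : ∀ j, lam i j = 0 := by
      simpa [Finset.filter_eq_empty_iff] using hempty
    have h1 := hl1 i
    simp [this] at h1
  have hk2 : ∀ i ∈ F, 2 ≤ Finset.card {j | lam i j ≠ 0} := by
    intro i hi
    by_contra hlt
    have h1 : Finset.card {j | lam i j ≠ 0} = 1 := by have := hkpos i; omega
    obtain ⟨a, ha⟩ := Finset.card_eq_one.1 h1
    have hi' : ∀ j, lam i j ≠ 1 := by simpa [hF] using hi
    refine hi' a ?_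
    rw [← hl1 i]
    refine (Finset.sum_eq_single a (fun j _ hj => ?_) (by simp)).symm
    by_contra h0
    have : j ∈ ({j | lam i j ≠ 0} : Finset _) := by simpa using h0
    rw [ha] at this
    exact hj (Finset.mem_singleton.1 this)
  have htotal : ∑ i, Finset.card {j | lam i j ≠ 0} ≤ n + d := by
    refine le_of_eq_of_le ?_ hcount
    rw [Set.ncard_eq_toFinset_card', ← Finset.card_sigma]
    refine Finset.card_bij (fun p _ => (p.1, p.2)) ?_ ?_ ?_
    · intro p hp; simpa using hp
    · rintro ⟨a, b⟩ _ ⟨a', b'⟩ _ hab; simpa using hab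
    · rintro ⟨a, b⟩ hp; exact ⟨⟨a, b⟩, by simpa using hp, rfl⟩
  have hK : ∑ i ∈ F, Finset.card {j | lam i j ≠ 0} ≤ d + F.card := by
    have h1 := Finset.card_nsmul_le_sum Fᶜ _ 1 fun i _ => hkpos i
    have h2 := Finset.sum_add_sum_compl F fun i => Finset.card {j | lam i j ≠ 0}
    have h3 := Finset.card_add_card_compl F
    simp only [smul_eq_mul, mul_one, Fintype.card_fin] at h1 h3
    omega
  have hFd : F.card ≤ d := by
    have := Finset.card_nsmul_le_sum F _ _ hk2
    rw [smul_eq_mul] at this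
    omega
  -- outside `F` one coefficient is `1` and the others vanish
  have hpure : ∀ i, i ∉ F → ∑ j, lam i j • v i j ∈ V i := by
    intro i hi
    obtain ⟨a, ha⟩ : ∃ a, lam i a = 1 := by simpa [hF] using hi
    have h0 : ∀ j, j ≠ a → lam i j = 0 := by
      intro j hj
      have h1 := hl1 i
      rw [← Finset.add_sum_erase _ _ (Finset.mem_univ a), ha] at h1
      exact (Finset.sum_eq_zero_iff_of_nonneg fun j _ => hl i j).1 (by linarith) j
        (Finset.mem_erase.2 ⟨hj, Finset.mem_univ j⟩)
    rw [Finset.sum_eq_single a (fun j _ hj => by rw [h0 j hj, zero_smul]) (by simp), ha, one_smul]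
    exact hvV i a
  have hrange : ∀ i, Set.range (v i) ⊆ V i := fun i => Set.range_subset_iff.2 (hvV i)
  rcases Nat.eq_zero_or_pos F.card with hF0 | hF1
  · rw [Finset.card_eq_zero] at hF0
    have hp : ∀ i, ∑ j, lam i j • v i j ∈ V i := fun i => hpure i (by simp [hF0])
    refine ⟨fun i => ∑ j, lam i j • v i j, ∅, ∅, 0, subset_rfl, by simp, by simp, by simp,
      fun i => subset_convexHull ℝ _ (hp i), fun i _ => hp i, by simp [hx], ?_⟩
    simp [ApproxSF.sampleSize]
  have hRv : ∀ i j, lam i j ≠ 1 → N (lam i j • v i j) ≤ ApproxSF.Rv N lam v := fun i j hij =>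
    le_ciSup (f := fun p : {p : Fin n × Fin (d + 1) // lam p.1 p.2 ≠ 1} =>
      N (lam p.1.1 p.1.2 • v p.1.1 p.1.2)) (Set.finite_range _).bddAbove ⟨(i, j), hij⟩
  -- a fractional summand has a coefficient other than `0` and `1`, so `R_λ > 0`
  have hRpos : 0 < R := by
    obtain ⟨i, hi⟩ := Finset.card_pos.1 hF1
    have hi' : ∀ j, lam i j ≠ 1 := by simpa [hF] using hi
    obtain ⟨j, hj⟩ := Finset.card_pos.1 (hkpos i)
    have hj' : lam i j ≠ 0 := by simpa using hj
    have h1 : |lam i j| ≤ ApproxSF.Rlam lam :=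
      le_ciSup (f := fun p : {p : Fin n × Fin (d + 1) // lam p.1 p.2 ≠ 1} => |lam p.1.1 p.1.2|)
        (Set.finite_range _).bddAbove ⟨(i, j), hi' j⟩
    exact (mul_pos hγ ((abs_pos.2 hj').trans_le h1)).trans_le (le_max_right _ _)
  have hr : ∀ i ∈ F, ∀ j, N (lam i j • v i j) ≤ R / (β * D) := by
    intro i hi j
    have hi' : ∀ j, lam i j ≠ 1 := by simpa [hF] using hi
    refine (hRv i j (hi' j)).trans ?_
    rw [le_div_iff₀ (by positivity), mul_comm]
    exact le_max_left _ _
  obtain ⟨Y, S, q, hSF, hSq, hq1, hqF, hco, hmem, herr, hm⟩ := ApproxSF.exists_rounding h F lam v d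
    (r := R / (β * D)) (δ := R / ε) hD (by positivity) (by positivity) hl hl1 hr hk2 hK hF1
  refine ⟨fun i => if i ∈ F then Y i else ∑ j, lam i j • v i j, S, F, q, hSF, hSq, hqF, hFd,
    ?_, ?_, ?_, ?_⟩
  · intro i
    dsimp only
    split_ifs with hi
    · exact convexHull_mono (hrange i) (hco i hi)
    · exact subset_convexHull ℝ _ (hpure i hi)
  · intro i hiS
    dsimp only
    split_ifs with hi
    · exact hrange i (hmem i hi hiS)
    · exact hpure i hi
  · have e : ∑ i, (if i ∈ F then Y i else ∑ j, lam i j • v i j) - x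
        = ∑ i ∈ F, (Y i - ∑ j, lam i j • v i j) := by
      rw [hx, ← Finset.sum_sub_distrib, ← Finset.sum_subset (Finset.subset_univ F)
        fun i _ hi => by simp [hi]]
      exact Finset.sum_congr rfl fun i hi => by simp [hi]
    rw [map_sub_rev, e]
    have e2 : (q : ℝ) * (D * (R / (β * D))) = R / ε * (q / β * ε) := by field_simp
    rw [e2] at herr
    exact le_of_mul_le_mul_left herr (by positivity)
  · have hq0 : (0 : ℝ) < q := by exact_mod_cast hq1
    have e : (√((d : ℝ) + q) * R / (q * ε)) ^ 2 = ((d : ℝ) + q) * (R / ε) ^ 2 / q ^ 2 := by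
      rw [div_pow, mul_pow, Real.sq_sqrt (by positivity)]
      field_simp
    rw [ApproxSF.sampleSize, e]
    exact hm
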